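/- Let $\mathbb O=\mathbb H\oplus\mathbb H$ be the octonions with the product $(q_1,q_2)(p_1,p_2)=(q_1p_1-\overline{p_2}q_2,\;p_2q_1+q_2\overline{p_1})$, conjugation $\overline{(q_1,q_2)}=(\overline{q_1},-q_2)$, inner product $\langle a,b\rangle=\mathrm{Re}(a\bar b)$, $|a|^2=\langle a,a\rangle$, and standard orthonormal basis $x_1,\dots,x_8$. Let $\mathbb OP^2=\mathcal U/\!\sim$, where $\mathcal U\subset\mathbb O^3$ is the set of triples with at least one entry equal to $1$, and $(a,b,c)\sim(a',b',c')$ iff $(a,b,c)=(a'\lambda,b'\lambda,c'\lambda)$ for some $\lambda\in\mathbb O\setminus\{0\}$. It is a smooth $16$-manifold with the three charts $[1,u,v]\mapsto(u,v)$, $[u,1,v]\mapsto(u,v)$, $[u,v,1]\mapsto(u,v)$, and it carries the Riemannian metric that is given in each of these charts by $$ds^2=\frac{|du|^2(1+|v|^2)+|dv|^2(1+|u|^2)-2\,\mathrm{Re}[(u\bar v)(dv\,d\bar u)]}{(1+|u|^2+|v|^2)^2}.$$ Let $P_0=[1,0,0]$, let $e_i=\partial_i$, $f_i=\partial_{i+8}$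 ($1\le i\le 8$) be the coordinate frame at $P_0$ of the chart $[1,u,v]\mapsto(u,v)$ (so $e_i$ corresponds to $(x_i,0)$ and $f_i$ to $(0,x_i)$), and let $R(X,Y,Z,W)=g(R(X,Y)Z,W)$ be the Riemann curvature tensor at $P_0$, with the sign convention $R(X,Y)Z=\nabla_Y\nabla_XZ-\nabla_X\nabla_YZ+\nabla_{[X,Y]}Z$. **Theorem.** For all $i,j,k,l\in\{1,\dots,8\}$: 1. if $i\neq j$, then $R(e_i,e_j,e_i,e_j)=-R(e_i,e_j,e_j,e_i)=4$; 2. if $i\neq j$, then $R(f_i,f_j,f_i,f_j)=-R(f_i,f_j,f_j,f_i)=4$; 3. $R(e_i,e_j,f_k,f_l)=R(f_k,f_l,e_i,e_j)=-\langle x_i\overline{x_l},x_j\overline{x_k}\rangle+\langle x_j\overline{x_l},x_i\overline{x_k}\rangle$; 4. $R(e_i,f_j,e_k,f_l)=R(f_i,e_j,f_k,e_l)=\langle x_i\overline{x_j},x_k\overline{x_l}\rangle$ and $R(e_i,f_j,f_l,e_k)=R(f_i,e_j,e_l,f_k)=-\langle x_i\overline{x_j},x_k\overline{x_l}\rangle$.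 All components of $R$ at $P_0$ in this frame that are not listed in 1–4 vanish. **Corollary.** If the pair $(a,b)=(\sum a_ix_i,\sum b_ix_i)\in\mathbb O^2$ is identified with the tangent vector $\sum a_ie_i+\sum b_if_i$ at $P_0$, then for all $a,b,c,d,e,f,g,h\in\mathbb O$ $$\begin{aligned}R\big((a,b),(c,d),(e,f),(g,h)\big)={}&4\langle a,e\rangle\langle c,g\rangle-4\langle c,e\rangle\langle a,g\rangle+4\langle b,f\rangle\langle d,h\rangle-4\langle d,f\rangle\langle b,h\rangle\\&-\langle e\bar d,g\bar b\rangle+\langle e\bar b,g\bar d\rangle-\langle c\bar f,a\bar h\rangle+\langle a\bar f,c\bar h\rangle-\langle a\bar d-c\bar b,\;g\bar f-e\bar h\rangle.\end{aligned}$$ -/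

import Mathlib

open scoped Quaternion

noncomputable section

/-! ### Octonions -/

/-- The octonions, as pairs of quaternions; the norm is the Euclidean one. -/
def Octonion : Type := WithLp 2 (ℍ[ℝ] × ℍ[ℝ])

namespace Octonion

instance : NormedAddCommGroup Octonion :=
  inferInstanceAs (NormedAddCommGroup (WithLp 2 (ℍ[ℝ] × ℍ[ℝ])))
instance : InnerProductSpace ℝ Octonion :=
  inferInstanceAs (InnerProductSpace ℝ (WithLp 2 (ℍ[ℝ] × ℍ[ℝ])))
instance : FiniteDimensional ℝ Octonion :=
  inferInstanceAs (FiniteDimensional ℝ (WithLp 2 (ℍ[ℝ] × ℍ[ℝ])))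

/-- The octonion `(p, q)`. -/
def mk (p q : ℍ[ℝ]) : Octonion := WithLp.toLp 2 (p, q)
/-- First quaternionic component. -/
def fst (a : Octonion) : ℍ[ℝ] := WithLp.fst a
/-- Second quaternionic component. -/
def snd (a : Octonion) : ℍ[ℝ] := WithLp.snd a

@[simp] theorem fst_mk (p q : ℍ[ℝ]) : (mk p q).fst = p := rfl
@[simp] theorem snd_mk (p q : ℍ[ℝ]) : (mk p q).snd = q := rfl
@[ext] theorem ext {a b : Octonion} (h₁ : a.fst = b.fst) (h₂ : a.snd = b.snd) : a = b :=
  congrArg (WithLp.toLp 2) (Prod.ext h₁ h₂)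
@[simp] theorem fst_add (a b : Octonion) : (a + b).fst = a.fst + b.fst := rfl
@[simp] theorem snd_add (a b : Octonion) : (a + b).snd = a.snd + b.snd := rfl
@[simp] theorem fst_zero : (0 : Octonion).fst = 0 := rfl
@[simp] theorem snd_zero : (0 : Octonion).snd = 0 := rfl
@[simp] theorem fst_neg (a : Octonion) : (-a).fst = -a.fst := rfl
@[simp] theorem snd_neg (a : Octonion) : (-a).snd = -a.snd := rfl
@[simp] theorem fst_sub (a b : Octonion) : (a - b).fst = a.fst - b.fst := rfl
@[simp] theorem snd_sub (a b : Octonion) : (a - b).snd = a.snd - b.snd := rfl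
@[simp] theorem fst_smul (r : ℝ) (a : Octonion) : (r • a).fst = r • a.fst := rfl
@[simp] theorem snd_smul (r : ℝ) (a : Octonion) : (r • a).snd = r • a.snd := rfl

/-- Cayley-Dickson multiplication. -/
instance : Mul Octonion :=
  ⟨fun a b => mk (a.fst * b.fst - star b.snd * a.snd) (b.snd * a.fst + a.snd * star b.fst)⟩
instance : One Octonion := ⟨mk 1 0⟩
/-- Octonionic conjugation. -/
instance : Star Octonion := ⟨fun a => mk (star a.fst) (-a.snd)⟩

@[simp] theorem fst_mul (a b : Octonion) :
    (a * b).fst = a.fst * b.fst - star b.snd * a.snd := rfl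
@[simp] theorem snd_mul (a b : Octonion) :
    (a * b).snd = b.snd * a.fst + a.snd * star b.fst := rfl
@[simp] theorem fst_one : (1 : Octonion).fst = 1 := rfl
@[simp] theorem snd_one : (1 : Octonion).snd = 0 := rfl
@[simp] theorem fst_star (a : Octonion) : (star a).fst = star a.fst := rfl
@[simp] theorem snd_star (a : Octonion) : (star a).snd = -a.snd := rfl

/-- The octonions form a (non-associative) unital ring. -/
instance : NonAssocRing Octonion :=
  { (inferInstance : AddCommGroup Octonion), (inferInstance : Mul Octonion),
    (inferInstance : One Octonion) with
    left_distrib := fun a b c => by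
      ext1 <;> simp only [fst_mul, snd_mul, fst_add, snd_add, star_add] <;> noncomm_ring
    right_distrib := fun a b c => by
      ext1 <;> simp only [fst_mul, snd_mul, fst_add, snd_add] <;> noncomm_ring
    zero_mul := fun a => by ext1 <;> simp
    mul_zero := fun a => by ext1 <;> simp
    one_mul := fun a => by ext1 <;> simp
    mul_one := fun a => by ext1 <;> simp }

instance : IsScalarTower ℝ Octonion Octonion :=
  ⟨fun r a b => by ext1 <;> simp [smul_sub, smul_add]⟩
instance : SMulCommClass ℝ Octonion Octonion :=
  ⟨fun r a b => by ext1 <;> simp [smul_sub, smul_add]⟩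

/-- Real part. -/
def re (a : Octonion) : ℝ := a.fst.re

/-- The inner product `<a, b> = Re (a b̄)`. -/
def ip (a b : Octonion) : ℝ := re (a * star b)

/-- The squared norm `|a|² = <a, a>`. -/
def normSq (a : Octonion) : ℝ := ip a a

/-- The inverse `a⁻¹ = |a|⁻² ā` (with `0⁻¹ = 0`). -/
instance : Inv Octonion := ⟨fun a => (normSq a)⁻¹ • star a⟩

theorem inv_def (a : Octonion) : a⁻¹ = (normSq a)⁻¹ • star a := rfl

/-- The eight real coordinates of an octonion. -/
def coords : Octonion ≃ₗ[ℝ] (Fin 8 → ℝ) where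
  toFun a := ![a.fst.re, a.fst.imI, a.fst.imJ, a.fst.imK,
    a.snd.re, a.snd.imI, a.snd.imJ, a.snd.imK]
  invFun c := mk ⟨c 0, c 1, c 2, c 3⟩ ⟨c 4, c 5, c 6, c 7⟩
  map_add' a b := by ext i; fin_cases i <;> simp
  map_smul' r a := by ext i; fin_cases i <;> simp
  left_inv a := by ext <;> rfl
  right_inv c := by ext i; fin_cases i <;> rfl

/-- The standard basis `x₁, …, x₈`, that is
`(1,0), (i,0), (j,0), (k,0), (0,1), (0,i), (0,j), (0,k)`. -/
def x : Module.Basis (Fin 8) ℝ Octonion := .ofEquivFun coords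

theorem ip_eq (a b : Octonion) : ip a b =
    a.fst.re * b.fst.re + a.fst.imI * b.fst.imI + a.fst.imJ * b.fst.imJ + a.fst.imK * b.fst.imK +
    a.snd.re * b.snd.re + a.snd.imI * b.snd.imI + a.snd.imJ * b.snd.imJ
      + a.snd.imK * b.snd.imK := by
  simp [ip, re]; ring

theorem ip_self (a : Octonion) : ip a a = ‖a‖ ^ 2 := by
  have h : ‖a‖ ^ 2 = ‖a.fst‖ ^ 2 + ‖a.snd‖ ^ 2 := WithLp.prod_norm_sq_eq_of_L2 a
  rw [h, ip_eq, sq ‖a.fst‖, sq ‖a.snd‖, ← Quaternion.normSq_eq_norm_mul_self,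
    ← Quaternion.normSq_eq_norm_mul_self, Quaternion.normSq_def', Quaternion.normSq_def']
  ring

theorem normSq_eq (a : Octonion) : normSq a = ‖a‖ ^ 2 := ip_self a

theorem normSq_ne_zero {a : Octonion} : normSq a ≠ 0 ↔ a ≠ 0 := by
  rw [normSq_eq]; simp

theorem normSq_mul (a b : Octonion) : normSq (a * b) = normSq a * normSq b := by
  simp only [normSq, ip_eq]; simp; ring

theorem star_mul' (a b : Octonion) : star (a * b) = star b * star a := by
  ext1 <;> simp [sub_eq_add_neg]

theorem mul_mul_star (a b : Octonion) : (a * b) * star b = normSq b • a := by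
  simp only [normSq, ip_eq]; ext <;> simp <;> ring

theorem star_mul_mul (a b : Octonion) : star b * (b * a) = normSq b • a := by
  simp only [normSq, ip_eq]; ext <;> simp <;> ring

theorem mul_star_mul (a b : Octonion) : b * (star b * a) = normSq b • a := by
  simp only [normSq, ip_eq]; ext <;> simp <;> ring

theorem ip_eq_inner (a b : Octonion) : ip a b = inner ℝ a b := by
  have h : inner ℝ a b = inner ℝ a.fst b.fst + inner ℝ a.snd b.snd :=
    WithLp.prod_inner_apply (𝕜 := ℝ) (E := ℍ[ℝ]) (F := ℍ[ℝ]) a b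
  rw [h, ip_eq, Quaternion.inner_def, Quaternion.inner_def]
  simp; ring

end Octonion

namespace Octonion

theorem normSq_one : normSq 1 = 1 := by simp [normSq, ip, re]

theorem mul_inv_cancel_right {b : Octonion} (hb : b ≠ 0) (a : Octonion) : (a * b) * b⁻¹ = a := by
  rw [inv_def, mul_smul_comm, mul_mul_star, smul_smul, inv_mul_cancel₀ (normSq_ne_zero.2 hb),
    one_smul]

theorem inv_mul_cancel_left {b : Octonion} (hb : b ≠ 0) (a : Octonion) : b⁻¹ * (b * a) = a := by
  rw [inv_def, smul_mul_assoc, star_mul_mul, smul_smul, inv_mul_cancel₀ (normSq_ne_zero.2 hb),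
    one_smul]

theorem mul_inv_cancel_left {b : Octonion} (hb : b ≠ 0) (a : Octonion) : b * (b⁻¹ * a) = a := by
  rw [inv_def, smul_mul_assoc, mul_smul_comm, mul_star_mul, smul_smul,
    inv_mul_cancel₀ (normSq_ne_zero.2 hb), one_smul]

theorem mul_inv_self {b : Octonion} (hb : b ≠ 0) : b * b⁻¹ = 1 := by
  simpa using mul_inv_cancel_right hb 1

theorem inv_zero' : (0 : Octonion)⁻¹ = 0 := by
  rw [inv_def]; simp [normSq, ip, re]

theorem inv_one' : (1 : Octonion)⁻¹ = 1 := by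
  rw [inv_def, normSq_one, inv_one, one_smul]; ext1 <;> simp

theorem mul_inv_rev' (a b : Octonion) : (a * b)⁻¹ = b⁻¹ * a⁻¹ := by
  rw [inv_def, inv_def, inv_def, normSq_mul, star_mul', smul_mul_smul_comm, mul_inv, mul_comm]

theorem mul_ne_zero' {a b : Octonion} (ha : a ≠ 0) (hb : b ≠ 0) : a * b ≠ 0 := by
  rw [← normSq_ne_zero, normSq_mul]
  exact mul_ne_zero (normSq_ne_zero.2 ha) (normSq_ne_zero.2 hb)

theorem one_ne_zero' : (1 : Octonion) ≠ 0 := by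
  rw [← normSq_ne_zero, normSq_one]; exact one_ne_zero

theorem inv_ne_zero' {a : Octonion} (ha : a ≠ 0) : a⁻¹ ≠ 0 := by
  intro h
  have := mul_inv_self ha
  rw [h, mul_zero] at this
  exact one_ne_zero' this.symm

theorem ne_zero_of_mul_eq_one {a b : Octonion} (h : a * b = 1) : a ≠ 0 := by
  rintro rfl
  rw [zero_mul] at h
  exact one_ne_zero' h.symm

theorem eq_inv_of_mul_eq_one {a b : Octonion} (h : a * b = 1) : b = a⁻¹ := by
  rw [← inv_mul_cancel_left (ne_zero_of_mul_eq_one h) b, h, mul_one]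

theorem inv_inv' (a : Octonion) : a⁻¹⁻¹ = a := by
  by_cases ha : a = 0
  · rw [ha, inv_zero', inv_zero']
  · have := mul_inv_cancel_left ha a⁻¹⁻¹
    rw [mul_inv_self (inv_ne_zero' ha), mul_one] at this
    exact this.symm

theorem contDiff_mul : ContDiff ℝ ⊤ fun p : Octonion × Octonion => p.1 * p.2 :=
  (LinearMap.mul ℝ Octonion).toContinuousBilinearMap.isBoundedBilinearMap.contDiff

instance : ContinuousMul Octonion := ⟨contDiff_mul.continuous⟩

/-- Conjugation as a linear map. -/
def starL : Octonion →ₗ[ℝ] Octonion where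
  toFun := star
  map_add' a b := by ext1 <;> simp; abel
  map_smul' r a := by ext1 <;> simp

theorem contDiff_star : ContDiff ℝ ⊤ fun a : Octonion => star a :=
  (LinearMap.toContinuousLinearMap starL).contDiff

theorem contDiffAt_inv {a : Octonion} (ha : a ≠ 0) :
    ContDiffAt ℝ ⊤ (fun a : Octonion => a⁻¹) a := by
  have h : ContDiffAt ℝ ⊤ (fun a : Octonion => (‖a‖ ^ 2)⁻¹) a :=
    (contDiff_norm_sq ℝ).contDiffAt.inv (by simpa using ha)
  refine (h.smul contDiff_star.contDiffAt).congr_of_eventuallyEq (.of_forall fun b => ?_)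
  simp [inv_def, normSq_eq]

end Octonion

/-! ### The octonionic projective plane -/

/-- The set `𝒰 = U₁ ∪ U₂ ∪ U₃ ⊆ 𝕆³` of triples with at least one entry equal to `1`. -/
abbrev ReducedTriple : Type := {p : Fin 3 → Octonion // ∃ i, p i = 1}

namespace ReducedTriple

/-- `p ~ q` iff `p = q l` for some non-zero octonion `l`. -/
def Rel (p q : ReducedTriple) : Prop :=
  ∃ l : Octonion, l ≠ 0 ∧ ∀ i, p.1 i = q.1 i * l

theorem Rel.ne_zero {p q : ReducedTriple} (h : Rel p q) {i : Fin 3} (hi : q.1 i ≠ 0) :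
    p.1 i ≠ 0 := by
  obtain ⟨l, hl, h⟩ := h
  rw [h]; exact Octonion.mul_ne_zero' hi hl

theorem Rel.symm {p q : ReducedTriple} (h : Rel p q) : Rel q p := by
  obtain ⟨l, hl, h⟩ := h
  exact ⟨l⁻¹, Octonion.inv_ne_zero' hl, fun i => by
    rw [h, Octonion.mul_inv_cancel_right hl]⟩

theorem Rel.ratio {p q : ReducedTriple} (h : Rel p q) (i j : Fin 3) :
    p.1 j * (p.1 i)⁻¹ = q.1 j * (q.1 i)⁻¹ := by
  by_cases hi : q.1 i = 0
  · obtain ⟨l, hl, h⟩ := h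
    rw [h i, hi, zero_mul, Octonion.inv_zero', mul_zero, mul_zero]
  have hpi := h.ne_zero hi
  obtain ⟨l, hl, h⟩ := h
  obtain ⟨m, hm⟩ := q.2
  obtain ⟨n, hn⟩ := p.2
  by_cases hij : i = j
  · rw [← hij, Octonion.mul_inv_self hi, Octonion.mul_inv_self hpi]
  rw [h n] at hn
  have hn' := Octonion.eq_inv_of_mul_eq_one hn
  rw [h i, h j]
  by_cases h1 : m = i
  · rw [← h1, hm, one_mul, Octonion.mul_inv_cancel_right hl, Octonion.inv_one', mul_one]
  by_cases h2 : m = j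
  · rw [← h2, hm, one_mul, one_mul, Octonion.mul_inv_rev', Octonion.mul_inv_cancel_left hl]
  by_cases h3 : n = i
  · rw [← h3, hn, Octonion.inv_one', mul_one, hn']
  by_cases h4 : n = j
  · rw [← h4, hn, one_mul, Octonion.mul_inv_rev', hn', Octonion.inv_inv']
  have h5 : m = n := by omega
  rw [← h5, hm, one_mul] at hn
  rw [hn, mul_one, mul_one]

theorem Rel.trans {p q r : ReducedTriple} (h₁ : Rel p q) (h₂ : Rel q r) : Rel p r := by
  obtain ⟨n, hn⟩ := p.2
  have hp : p.1 n ≠ 0 := by rw [hn]; exact Octonion.one_ne_zero'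
  refine ⟨(r.1 n)⁻¹, Octonion.inv_ne_zero' (h₂.symm.ne_zero (h₁.symm.ne_zero hp)), fun j => ?_⟩
  rw [← h₂.ratio, ← h₁.ratio, hn, Octonion.inv_one', mul_one]

/-- `~` is an equivalence relation on `𝒰`. -/
def setoid : Setoid ReducedTriple where
  r := Rel
  iseqv := ⟨fun _ => ⟨1, Octonion.one_ne_zero', fun _ => (mul_one _).symm⟩, .symm, .trans⟩

end ReducedTriple

/-- The octonionic projective plane `𝕆P² = 𝒰 / ~`, with the quotient topology. -/
def OP2 : Type := Quotient ReducedTriple.setoid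

namespace OP2

instance : TopologicalSpace OP2 := inferInstanceAs (TopologicalSpace (Quotient _))

/-- The class of a reduced triple. -/
def ofTriple (p : ReducedTriple) : OP2 := Quotient.mk _ p

/-- The chart domain `Uᵢ / ~`: the classes that have a representative with `i`-th entry `1`. -/
def U (i : Fin 3) : Set OP2 := {P | ∃ p : ReducedTriple, p.1 i = 1 ∧ ofTriple p = P}

/-- The class of the triple with `i`-th entry `1` and the other two entries `u`, `v`, in this order:
`[1,u,v]`, `[u,1,v]` or `[u,v,1]`. -/
def point (i : Fin 3) (w : Octonion × Octonion) : OP2 :=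
  ofTriple ⟨i.insertNth 1 ![w.1, w.2], i, by simp⟩

/-- The coordinates `(p_j p_i⁻¹, p_k p_i⁻¹)` of `[p]`, where `j < k` are the two indices other than
`i`. On a representative with `p_i = 1` these are the two other entries. -/
def coord (i : Fin 3) : OP2 → Octonion × Octonion :=
  Quotient.lift
    (fun p : ReducedTriple =>
      (p.1 (i.succAbove 0) * (p.1 i)⁻¹, p.1 (i.succAbove 1) * (p.1 i)⁻¹))
    (fun _ _ h => Prod.ext (ReducedTriple.Rel.ratio h _ _) (ReducedTriple.Rel.ratio h _ _))

theorem coord_ofTriple (i : Fin 3) (p : ReducedTriple) : coord i (ofTriple p) =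
    (p.1 (i.succAbove 0) * (p.1 i)⁻¹, p.1 (i.succAbove 1) * (p.1 i)⁻¹) := rfl

theorem point_mem (i : Fin 3) (w : Octonion × Octonion) : point i w ∈ U i :=
  ⟨_, by simp, rfl⟩

theorem coord_point (i : Fin 3) (w : Octonion × Octonion) : coord i (point i w) = w := by
  rw [point, coord_ofTriple]
  simp [Octonion.inv_one']

theorem point_coord {i : Fin 3} {P : OP2} (hP : P ∈ U i) : point i (coord i P) = P := by
  obtain ⟨p, hp, rfl⟩ := hP
  rw [coord_ofTriple, hp, Octonion.inv_one', mul_one, mul_one, point]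
  congr 1
  apply Subtype.ext
  funext j
  rcases Fin.eq_self_or_eq_succAbove i j with rfl | ⟨k, rfl⟩
  · simp [hp]
  · fin_cases k <;> simp

theorem ofTriple_mem {i : Fin 3} {p : ReducedTriple} : ofTriple p ∈ U i ↔ p.1 i ≠ 0 := by
  constructor
  · rintro ⟨q, hq, h⟩
    have h' : ReducedTriple.Rel q p := Quotient.exact h
    exact h'.symm.ne_zero (by rw [hq]; exact Octonion.one_ne_zero')
  · intro h
    obtain ⟨n, hn⟩ := p.2
    refine ⟨⟨fun j => p.1 j * (p.1 i)⁻¹, i, Octonion.mul_inv_self h⟩,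
      Octonion.mul_inv_self h, Quotient.sound ⟨(p.1 i)⁻¹, Octonion.inv_ne_zero' h, fun j => rfl⟩⟩

theorem continuous_ofTriple : Continuous ofTriple := continuous_quot_mk

theorem isOpen_U (i : Fin 3) : IsOpen (U i) := by
  have h : IsOpen (ofTriple ⁻¹' U i) := by
    have : ofTriple ⁻¹' U i = {p | p.1 i ≠ 0} := by ext p; exact ofTriple_mem
    rw [this]
    exact isOpen_ne.preimage ((continuous_apply i).comp continuous_subtype_val)
  exact h

theorem continuous_point (i : Fin 3) : Continuous (point i) := by
  refine continuous_ofTriple.comp (Continuous.subtype_mk ?_ _)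
  refine continuous_pi fun j => ?_
  rcases Fin.eq_self_or_eq_succAbove i j with rfl | ⟨k, rfl⟩
  · simpa using continuous_const
  · fin_cases k
    · simpa using continuous_fst
    · simpa using continuous_snd

theorem continuousOn_coord (i : Fin 3) : ContinuousOn (coord i) (U i) := by
  have hq : Topology.IsQuotientMap ofTriple := isQuotientMap_quot_mk
  rw [hq.continuousOn_isOpen_iff (isOpen_U i)]
  intro p hp
  have hp' : p.1 i ≠ 0 := ofTriple_mem.1 hp
  have hc : ∀ j, ContinuousAt (fun p : ReducedTriple => p.1 j) p := fun j =>
    ((continuous_apply j).comp continuous_subtype_val).continuousAt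
  have hi : ContinuousAt (fun p : ReducedTriple => (p.1 i)⁻¹) p :=
    ContinuousAt.comp (f := fun p : ReducedTriple => p.1 i)
      (g := fun a : Octonion => a⁻¹) (Octonion.contDiffAt_inv hp').continuousAt (hc i)
  exact (((hc _).mul hi).prodMk ((hc _).mul hi)).continuousWithinAt

/-- The chart `φᵢ : Uᵢ / ~ → 𝕆 × 𝕆`. -/
def chart (i : Fin 3) : OpenPartialHomeomorph OP2 (Octonion × Octonion) where
  toFun := coord i
  invFun := point i
  source := U i
  target := Set.univ
  map_source' _ _ := Set.mem_univ _
  map_target' w _ := point_mem i w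
  left_inv' _ hP := point_coord hP
  right_inv' w _ := coord_point i w
  open_source := isOpen_U i
  open_target := isOpen_univ
  continuousOn_toFun := continuousOn_coord i
  continuousOn_invFun := (continuous_point i).continuousOn

theorem exists_mem_U (P : OP2) : ∃ i, P ∈ U i := by
  obtain ⟨p, rfl⟩ := Quotient.exists_rep P
  obtain ⟨i, hi⟩ := p.2
  exact ⟨i, p, hi, rfl⟩

open Classical in
/-- The index of the first chart domain that contains the point. -/
def chartIndex (P : OP2) : Fin 3 := if P ∈ U 0 then 0 else if P ∈ U 1 then 1 else 2

theorem mem_U_chartIndex (P : OP2) : P ∈ U (chartIndex P) := by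
  unfold chartIndex
  split_ifs with h0 h1
  · exact h0
  · exact h1
  · obtain ⟨i, hi⟩ := exists_mem_U P
    fin_cases i
    · exact absurd hi h0
    · exact absurd hi h1
    · exact hi

/-- The atlas `{φ₁, φ₂, φ₃}`. -/
instance : ChartedSpace (Octonion × Octonion) OP2 where
  atlas := Set.range chart
  chartAt P := chart (chartIndex P)
  mem_chart_source := mem_U_chartIndex
  chart_mem_atlas _ := Set.mem_range_self _

open scoped Manifold ContDiff

/-- The entries of the triple with `i`-th entry `1` and the other two `u`, `v`. -/
def entry (i k : Fin 3) (w : Octonion × Octonion) : Octonion :=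
  (i.insertNth 1 ![w.1, w.2] : Fin 3 → Octonion) k

theorem contDiff_entry (i k : Fin 3) : ContDiff ℝ ∞ (entry i k) := by
  unfold entry
  rcases Fin.eq_self_or_eq_succAbove i k with rfl | ⟨k, rfl⟩
  · simp only [Fin.insertNth_apply_same]
    exact contDiff_const
  · simp only [Fin.insertNth_apply_succAbove]
    fin_cases k
    · exact contDiff_fst
    · exact contDiff_snd

theorem coord_point_eq (i j : Fin 3) (w : Octonion × Octonion) : coord j (point i w) =
    (entry i (j.succAbove 0) w * (entry i j w)⁻¹, entry i (j.succAbove 1) w * (entry i j w)⁻¹) :=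
  rfl

/-- The transition maps are smooth. -/
theorem contDiffAt_transition (i j : Fin 3) (w : Octonion × Octonion) (hw : point i w ∈ U j) :
    ContDiffAt ℝ ∞ (fun w => coord j (point i w)) w := by
  simp only [coord_point_eq]
  have hw' : entry i j w ≠ 0 := ofTriple_mem.1 hw
  have hinv : ContDiffAt ℝ ∞ (fun w => (entry i j w)⁻¹) w :=
    ((Octonion.contDiffAt_inv hw').of_le le_top).comp w (contDiff_entry i j).contDiffAt
  have hmul : ∀ k, ContDiffAt ℝ ∞ (fun w => entry i k w * (entry i j w)⁻¹) w := by
    intro k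
    have h1 := (contDiff_entry i k).contDiffAt (x := w)
    have h2 := h1.prodMk hinv
    have h3 : ContDiffAt ℝ ∞ (fun p : Octonion × Octonion => p.1 * p.2)
      (entry i k w, (entry i j w)⁻¹) := Octonion.contDiff_mul.contDiffAt.of_le le_top
    exact ContDiffAt.comp (f := fun w => (entry i k w, (entry i j w)⁻¹))
      (g := fun p : Octonion × Octonion => p.1 * p.2) w h3 h2
  exact ContDiffAt.prodMk (hmul (j.succAbove 0)) (hmul (j.succAbove 1))

instance : IsManifold 𝓘(ℝ, Octonion × Octonion) ∞ OP2 := by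
  refine isManifold_of_contDiffOn _ _ _ ?_
  rintro _ _ ⟨i, rfl⟩ ⟨j, rfl⟩ w hw
  exact (contDiffAt_transition i j w hw.1.2).contDiffWithinAt

end OP2

/-! ### The Riemann curvature tensor of a metric, in coordinates -/

namespace CoordinateCurvature

variable {E : Type*} [NormedAddCommGroup E] [NormedSpace ℝ E]
  {ι : Type*} [Fintype ι] [DecidableEq ι]

/-- The partial derivative `∂_α f`, with respect to the linear coordinates given by `b`. -/
def partialDeriv (b : Module.Basis ι ℝ E) (α : ι) (f : E → ℝ) (y : E) : ℝ :=
  fderiv ℝ f y (b α)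

/-- The matrix `g_{αβ}` of a field `G` of bilinear forms on `E`. -/
def gram (b : Module.Basis ι ℝ E) (G : E → E → E → ℝ) (y : E) : Matrix ι ι ℝ :=
  Matrix.of fun α β => G y (b α) (b β)

/-- The Christoffel symbol
`Γ_{αβ}^δ = 1/2 ∑_ε g^{δε} (∂_α g_{βε} + ∂_β g_{αε} - ∂_ε g_{αβ})`. -/
def christoffel (b : Module.Basis ι ℝ E) (G : E → E → E → ℝ) (δ α β : ι) (y : E) : ℝ :=
  (1 / 2) * ∑ ε, (gram b G y)⁻¹ δ ε *
    (partialDeriv b α (fun z => gram b G z β ε) y + partialDeriv b β (fun z => gram b G z α ε) y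
      - partialDeriv b ε (fun z => gram b G z α β) y)

/-- The components `R_{αβγ}^δ` of `R(X,Y)Z = ∇_Y ∇_X Z - ∇_X ∇_Y Z + ∇_{[X,Y]} Z`, that is
`R(∂_α,∂_β)∂_γ = ∑_δ R_{αβγ}^δ ∂_δ`. With this sign, `R(X,Y,X,Y) = g(R(X,Y)X,Y)` is positive on the
round sphere. -/
def riemannUp (b : Module.Basis ι ℝ E) (G : E → E → E → ℝ) (α β γ δ : ι) (y : E) : ℝ :=
  partialDeriv b β (christoffel b G δ α γ) y - partialDeriv b α (christoffel b G δ β γ) y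
    + ∑ ε, (christoffel b G ε α γ y * christoffel b G δ β ε y
      - christoffel b G ε β γ y * christoffel b G δ α ε y)

/-- The components `R_{αβγδ} = g(R(∂_α,∂_β)∂_γ, ∂_δ)`. -/
def riemannLow (b : Module.Basis ι ℝ E) (G : E → E → E → ℝ) (α β γ δ : ι) (y : E) : ℝ :=
  ∑ ε, riemannUp b G α β γ ε y * gram b G y ε δ

open scoped Manifold

variable {M : Type*} [TopologicalSpace M] [ChartedSpace E M]

/-- The expression of a Riemannian metric on `M` in the preferred chart at `P`, i.e. its pull-back
under the inverse of that chart. -/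
def metricInChart (g : Bundle.RiemannianMetric (fun Q : M => TangentSpace 𝓘(ℝ, E) Q)) (P : M)
    (y v w : E) : ℝ :=
  g.inner ((chartAt E P).symm y) (mfderiv 𝓘(ℝ, E) 𝓘(ℝ, E) (chartAt E P).symm y v)
    (mfderiv 𝓘(ℝ, E) 𝓘(ℝ, E) (chartAt E P).symm y w)

/-- The Riemann curvature tensor `R(X,Y,Z,W)` of `g` at `P`. The tangent space at `P` is identified
with `E` through the preferred chart at `P`, so the coefficients of `X` in the coordinate frame of
that chart are `b.repr X`. -/
def riemannTensor (b : Module.Basis ι ℝ E)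
    (g : Bundle.RiemannianMetric (fun Q : M => TangentSpace 𝓘(ℝ, E) Q)) (P : M)
    (X Y Z W : TangentSpace 𝓘(ℝ, E) P) : ℝ :=
  ∑ α, ∑ β, ∑ γ, ∑ δ, b.repr X α * b.repr Y β * b.repr Z γ * b.repr W δ *
    riemannLow b (metricInChart g P) α β γ δ (chartAt E P P)

end CoordinateCurvature

/-! ### The metric of the octonionic projective plane -/

namespace Octonion

theorem norm_mul' (a b : Octonion) : ‖a * b‖ = ‖a‖ * ‖b‖ := by
  have h := normSq_mul a b
  rw [normSq_eq, normSq_eq, normSq_eq, ← mul_pow] at h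
  exact (sq_eq_sq₀ (norm_nonneg _) (by positivity)).1 h

theorem star_star' (a : Octonion) : star (star a) = a := by
  ext1 <;> simp

theorem norm_star' (a : Octonion) : ‖star a‖ = ‖a‖ := by
  have h : ‖star a‖ ^ 2 = ‖a‖ ^ 2 := by
    rw [← ip_self, ← ip_self, ip_eq, ip_eq]; simp
  exact (sq_eq_sq₀ (norm_nonneg _) (norm_nonneg _)).1 h

theorem re_mul_le (a b : Octonion) : re (a * b) ≤ ‖a‖ * ‖b‖ := by
  have h : re (a * b) = inner ℝ a (star b) := by rw [← ip_eq_inner, ip, star_star']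
  rw [h, ← norm_star' b]
  exact real_inner_le_norm _ _

theorem star_add' (a b : Octonion) : star (a + b) = star a + star b := starL.map_add a b
theorem star_smul' (r : ℝ) (a : Octonion) : star (r • a) = r • star a := starL.map_smul r a
theorem re_add (a b : Octonion) : re (a + b) = re a + re b := rfl
theorem re_smul (r : ℝ) (a : Octonion) : re (r • a) = r * re a := rfl

end Octonion

namespace OP2

open Octonion

/-- The polarization of the quadratic form
`ds² = (|du|²(1+|v|²) + |dv|²(1+|u|²) - 2 Re[(u v̄)(dv dū)]) / (1+|u|²+|v|²)²`
at the point `w = (u, v)` of a chart. -/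
def metricForm (w s t : Octonion × Octonion) : ℝ :=
  (ip s.1 t.1 * (1 + normSq w.2) + ip s.2 t.2 * (1 + normSq w.1)
    - (re ((w.1 * star w.2) * (s.2 * star t.1)) + re ((w.1 * star w.2) * (t.2 * star s.1))))
    / (1 + normSq w.1 + normSq w.2) ^ 2

theorem metricForm_self (w s : Octonion × Octonion) : metricForm w s s =
    (normSq s.1 * (1 + normSq w.2) + normSq s.2 * (1 + normSq w.1)
      - 2 * re ((w.1 * star w.2) * (s.2 * star s.1))) / (1 + normSq w.1 + normSq w.2) ^ 2 := by
  simp only [metricForm, normSq]; ring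

theorem metricForm_comm (w s t : Octonion × Octonion) :
    metricForm w s t = metricForm w t s := by
  simp only [metricForm, ip_eq_inner, real_inner_comm]; ring

theorem metricForm_add (w s s' t : Octonion × Octonion) :
    metricForm w (s + s') t = metricForm w s t + metricForm w s' t := by
  simp only [metricForm, ip, Prod.fst_add, Prod.snd_add, add_mul, mul_add, star_add', re_add]; ring

theorem metricForm_smul (w : Octonion × Octonion) (r : ℝ) (s t : Octonion × Octonion) :
    metricForm w (r • s) t = r * metricForm w s t := by
  simp only [metricForm, ip, Prod.smul_fst, Prod.smul_snd, star_smul', smul_mul_assoc,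
    mul_smul_comm, re_smul]; ring

theorem le_metricForm_self (w s : Octonion × Octonion) :
    (‖s.1‖ ^ 2 + ‖s.2‖ ^ 2) / (1 + ‖w.1‖ ^ 2 + ‖w.2‖ ^ 2) ^ 2 ≤ metricForm w s s := by
  have h := re_mul_le (w.1 * star w.2) (s.2 * star s.1)
  simp only [norm_mul', norm_star'] at h
  simp only [metricForm_self, normSq_eq]
  gcongr
  nlinarith [sq_nonneg (‖s.1‖ * ‖w.2‖ - ‖s.2‖ * ‖w.1‖)]

/-- `metricForm w` as a continuous bilinear form. -/
def metricFormL (w : Octonion × Octonion) :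
    Octonion × Octonion →L[ℝ] Octonion × Octonion →L[ℝ] ℝ :=
  (LinearMap.mk₂ ℝ (metricForm w) (metricForm_add w) (metricForm_smul w)
    (fun s t t' => by
      rw [metricForm_comm, metricForm_add, metricForm_comm w t, metricForm_comm w t'])
    (fun r s t => by
      rw [metricForm_comm, metricForm_smul, metricForm_comm w t, smul_eq_mul])).toContinuousBilinearMap

theorem metricForm_pos (w s : Octonion × Octonion) (hs : s ≠ 0) : 0 < metricForm w s s := by
  refine lt_of_lt_of_le ?_ (le_metricForm_self w s)
  have h : s.1 ≠ 0 ∨ s.2 ≠ 0 := by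
    by_contra! h
    exact hs (Prod.ext h.1 h.2)
  have : 0 < ‖s.1‖ ^ 2 + ‖s.2‖ ^ 2 := by
    rcases h with h | h
    · have := norm_pos_iff.2 h; positivity
    · have := norm_pos_iff.2 h; positivity
  positivity

theorem isVonNBounded_metricForm (w : Octonion × Octonion) :
    Bornology.IsVonNBounded ℝ {s : Octonion × Octonion | metricForm w s s < 1} := by
  rw [NormedSpace.isVonNBounded_iff, isBounded_iff_forall_norm_le]
  refine ⟨1 + ‖w.1‖ ^ 2 + ‖w.2‖ ^ 2, fun s hs => ?_⟩
  have h := (le_metricForm_self w s).trans (le_of_lt hs)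
  rw [div_le_one (by positivity)] at h
  rw [Prod.norm_def, max_le_iff]
  constructor <;> refine le_of_sq_le_sq ?_ (by positivity) <;>
    nlinarith [sq_nonneg ‖s.1‖, sq_nonneg ‖s.2‖]

open scoped Manifold

/-- The Riemannian metric of `𝕆P²`: in the charts it is given by `metricForm`. The expression is the
same in all three charts, and the transition maps preserve it, so that it does not matter which of
the charts around `P` is used; here it is the preferred one. -/
def metric : Bundle.RiemannianMetric
    (fun P : OP2 => TangentSpace 𝓘(ℝ, Octonion × Octonion) P) where
  inner P := metricFormL (chartAt (Octonion × Octonion) P P)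
  symm _ s t := metricForm_comm _ s t
  pos _ s hs := metricForm_pos _ s hs
  continuousAt P :=
    (((metricFormL (chartAt (Octonion × Octonion) P P)).continuous).clm_apply
      continuous_id).continuousAt
  isVonNBounded _ := isVonNBounded_metricForm _

/-- The point `P₀ = [1,0,0]`. -/
def P₀ : OP2 := point 0 (0, 0)

theorem chartAt_P₀ : chartAt (Octonion × Octonion) P₀ = chart 0 := by
  change chart (chartIndex P₀) = chart 0
  rw [chartIndex, if_pos (by exact point_mem 0 _)]

/-- The coordinate basis of `𝕆 × 𝕆`: first the `(x_i, 0)`, then the `(0, x_i)`. -/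
def frame : Module.Basis (Fin 8 ⊕ Fin 8) ℝ (Octonion × Octonion) := x.prod x

/-- The tangent vector at `P₀` that corresponds to the pair `(a, b) = (∑ aᵢ xᵢ, ∑ bᵢ xᵢ)`, that is
`∑ aᵢ eᵢ + ∑ bᵢ fᵢ`, in the chart `[1,u,v] ↦ (u,v)`. -/
def tangent (a b : Octonion) : TangentSpace 𝓘(ℝ, Octonion × Octonion) P₀ :=
  ((a, b) : Octonion × Octonion)

/-- The coordinate vector `e_i = ∂_i` at `P₀`. -/
def e (i : Fin 8) : TangentSpace 𝓘(ℝ, Octonion × Octonion) P₀ := frame (Sum.inl i)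

/-- The coordinate vector `f_i = ∂_{i+8}` at `P₀`. -/
def f (i : Fin 8) : TangentSpace 𝓘(ℝ, Octonion × Octonion) P₀ := frame (Sum.inr i)

theorem tangent_eq_sum (a b : Octonion) :
    tangent a b = ∑ i, x.repr a i • e i + ∑ i, x.repr b i • f i := by
  have h := frame.sum_repr ((a, b) : Octonion × Octonion)
  rw [Fintype.sum_sum_type] at h
  simp only [frame, Module.Basis.prod_repr_inl, Module.Basis.prod_repr_inr] at h
  exact h.symm

/-- The Riemann curvature tensor of `𝕆P²` at `P₀`. -/
def R (X Y Z W : TangentSpace 𝓘(ℝ, Octonion × Octonion) P₀) : ℝ :=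
  CoordinateCurvature.riemannTensor frame metric P₀ X Y Z W

end OP2

end

/-!
In an affine chart, the metric of the projective plane over a normed division algebra depends on the
multiplication only through the bilinear map `B u v = u v̄`, which satisfies `‖B u v‖ = ‖u‖ * ‖v‖`.
Each coefficient of the metric is `(c + N w w) / (1 + D w w) ^ 2` with bilinear `N` and `D`, hence
critical at `w = 0`, with second derivative `N + N.flip - (2 * c) • (D + D.flip)`. At a point where
all the coefficients are critical, the Christoffel symbols vanish and the curvature is a combination
of second derivatives of the metric. The polarized composition identity
`⟪B a b, B c d⟫ + ⟪B a d, B c b⟫ = 2 * ⟪a, c⟫ * ⟪b, d⟫` turns that combination into the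
component-free formula, and the components in the frame are special cases of it.
-/

section CriticalPoint

variable {𝕜 : Type*} [NontriviallyNormedField 𝕜] {E F : Type*} [NormedAddCommGroup E]
  [NormedSpace 𝕜 E] [NormedAddCommGroup F] [NormedSpace 𝕜 F] {y : E}

theorem hasFDerivAt_smul_of_continuousAt_of_eq_zero {p : E → 𝕜} {q : E → F} {q' : E →L[𝕜] F}
    (hp : ContinuousAt p y) (hq : HasFDerivAt q q' y) (hq0 : q y = 0) :
    HasFDerivAt (fun z ↦ p z • q z) (p y • q') y := by
  rw [hasFDerivAt_iff_isLittleO] at hq ⊢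
  have h_remainder : (fun z ↦ p z • (q z - q y - q' (z - y))) =o[nhds y] fun z ↦ z - y := by
    simpa using (hp.isBigO_one 𝕜).smul_isLittleO hq
  have h_increment : (fun z ↦ (p z - p y) • q' (z - y)) =o[nhds y] fun z ↦ z - y := by
    have := (Asymptotics.isLittleO_one_iff 𝕜).2 (tendsto_sub_nhds_zero_iff.2 hp)
    simpa using this.smul_isBigO (q'.isBigO_sub (nhds y) y)
  refine (h_remainder.add h_increment).congr_left fun z ↦ ?_
  simp only [hq0, sub_zero, smul_zero, smul_sub, sub_smul, smul_apply]
  abel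

variable {p q : E → 𝕜}

theorem fderiv_mul_of_fderiv_eq_zero (hp : DifferentiableAt 𝕜 p y) (hq : DifferentiableAt 𝕜 q y)
    (hp' : fderiv 𝕜 p y = 0) (hq' : fderiv 𝕜 q y = 0) : fderiv 𝕜 (p * q) y = 0 := by
  ext; simp [fderiv_mul hp hq, hp', hq']

theorem fderiv_div_of_fderiv_eq_zero (hp : DifferentiableAt 𝕜 p y) (hq : DifferentiableAt 𝕜 q y)
    (hp' : fderiv 𝕜 p y = 0) (hq' : fderiv 𝕜 q y = 0) (hq0 : q y ≠ 0) :
    fderiv 𝕜 (p / q) y = 0 := by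
  have hp : HasFDerivAt p 0 y := hp' ▸ hp.hasFDerivAt
  have hq : HasFDerivAt q 0 y := hq' ▸ hq.hasFDerivAt
  have h_inv : HasFDerivAt q⁻¹ _ y := (hasDerivAt_inv hq0).comp_hasFDerivAt y hq
  rw [div_eq_mul_inv, (hp.mul h_inv).fderiv]
  ext; simp

theorem fderiv_fderiv_mul_of_fderiv_eq_zero (hp : ContDiffAt 𝕜 2 p y) (hq : ContDiffAt 𝕜 2 q y)
    (hp' : fderiv 𝕜 p y = 0) (hq' : fderiv 𝕜 q y = 0) :
    fderiv 𝕜 (fderiv 𝕜 (p * q)) y =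
      p y • fderiv 𝕜 (fderiv 𝕜 q) y + q y • fderiv 𝕜 (fderiv 𝕜 p) y := by
  have h_leibniz : fderiv 𝕜 (p * q) =ᶠ[nhds y]
      fun z ↦ p z • fderiv 𝕜 q z + q z • fderiv 𝕜 p z := by
    filter_upwards [hp.eventually (by simp), hq.eventually (by simp)] with z hpz hqz
    exact fderiv_mul (hpz.differentiableAt two_ne_zero) (hqz.differentiableAt two_ne_zero)
  have hddp : DifferentiableAt 𝕜 (fderiv 𝕜 p) y :=
    (hp.fderiv_right_succ (n := 1)).differentiableAt one_ne_zero
  have hddq : DifferentiableAt 𝕜 (fderiv 𝕜 q) y :=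
    (hq.fderiv_right_succ (n := 1)).differentiableAt one_ne_zero
  rw [h_leibniz.fderiv_eq]
  exact ((hasFDerivAt_smul_of_continuousAt_of_eq_zero hp.continuousAt hddq.hasFDerivAt hq').add
    (hasFDerivAt_smul_of_continuousAt_of_eq_zero hq.continuousAt hddp.hasFDerivAt hp')).fderiv

theorem fderiv_fderiv_div_of_fderiv_eq_zero (hp : ContDiffAt 𝕜 2 p y) (hq : ContDiffAt 𝕜 2 q y)
    (hp' : fderiv 𝕜 p y = 0) (hq' : fderiv 𝕜 q y = 0) (hq0 : q y ≠ 0) :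
    fderiv 𝕜 (fderiv 𝕜 (p / q)) y =
      (q y)⁻¹ • (fderiv 𝕜 (fderiv 𝕜 p) y - (p y / q y) • fderiv 𝕜 (fderiv 𝕜 q) y) := by
  have h_mul : p / q * q =ᶠ[nhds y] p := by
    filter_upwards [hq.continuousAt.eventually_ne hq0] with z hz
    exact div_mul_cancel₀ (p z) hz
  have h_leibniz := fderiv_fderiv_mul_of_fderiv_eq_zero (hp.div hq hq0) hq
    (fderiv_div_of_fderiv_eq_zero (hp.differentiableAt two_ne_zero)
      (hq.differentiableAt two_ne_zero) hp' hq' hq0) hq'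
  rw [h_mul.fderiv.fderiv_eq] at h_leibniz
  rw [eq_inv_smul_iff₀ hq0, h_leibniz, Pi.div_apply]
  abel

end CriticalPoint

section QuadraticDivSq

variable {𝕜 : Type*} [NontriviallyNormedField 𝕜] {E : Type*} [NormedAddCommGroup E]
  [NormedSpace 𝕜 E]

theorem fderiv_const_add_bilinear_self (c : 𝕜) (B : E →L[𝕜] E →L[𝕜] 𝕜) :
    fderiv 𝕜 (fun z ↦ c + B z z) = B + B.flip := by
  funext y
  refine (((B.hasFDerivAt.clm_apply (hasFDerivAt_id y)).const_add c).congr_fderiv ?_).fderiv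
  ext; simp

theorem fderiv_const_add_bilinear_self_zero (c : 𝕜) (B : E →L[𝕜] E →L[𝕜] 𝕜) :
    fderiv 𝕜 (fun z ↦ c + B z z) 0 = 0 := by
  rw [fderiv_const_add_bilinear_self]
  ext; simp

theorem fderiv_fderiv_const_add_bilinear_self (c : 𝕜) (B : E →L[𝕜] E →L[𝕜] 𝕜) (y : E) :
    fderiv 𝕜 (fderiv 𝕜 fun z ↦ c + B z z) y = B + B.flip := by
  rw [fderiv_const_add_bilinear_self]
  exact (B + B.flip).fderiv

theorem fderiv_one_add_bilinear_self_mul_self_zero (D : E →L[𝕜] E →L[𝕜] 𝕜) :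
    fderiv 𝕜 ((fun z ↦ 1 + D z z) * fun z ↦ 1 + D z z) 0 = 0 :=
  fderiv_mul_of_fderiv_eq_zero (by fun_prop) (by fun_prop)
    (fderiv_const_add_bilinear_self_zero 1 D) (fderiv_const_add_bilinear_self_zero 1 D)

theorem contDiffAt_quadratic_div_sq_zero (c : 𝕜) (N D : E →L[𝕜] E →L[𝕜] 𝕜) :
    ContDiffAt 𝕜 2 (fun z ↦ (c + N z z) / (1 + D z z) ^ 2) 0 :=
  ContDiffAt.div (by fun_prop) (by fun_prop) (by simp)

theorem quadratic_div_sq_eq (c : 𝕜) (N D : E →L[𝕜] E →L[𝕜] 𝕜) :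
    (fun z ↦ (c + N z z) / (1 + D z z) ^ 2) =
      (fun z ↦ c + N z z) / ((fun z ↦ 1 + D z z) * fun z ↦ 1 + D z z) := by
  ext z; simp [sq]

theorem fderiv_quadratic_div_sq_zero (c : 𝕜) (N D : E →L[𝕜] E →L[𝕜] 𝕜) :
    fderiv 𝕜 (fun z ↦ (c + N z z) / (1 + D z z) ^ 2) 0 = 0 := by
  rw [quadratic_div_sq_eq]
  exact fderiv_div_of_fderiv_eq_zero (by fun_prop) (by fun_prop)
    (fderiv_const_add_bilinear_self_zero c N)
    (fderiv_one_add_bilinear_self_mul_self_zero D) (by simp)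

theorem fderiv_fderiv_quadratic_div_sq_zero (c : 𝕜) (N D : E →L[𝕜] E →L[𝕜] 𝕜) :
    fderiv 𝕜 (fderiv 𝕜 fun z ↦ (c + N z z) / (1 + D z z) ^ 2) 0 =
      N + N.flip - (2 * c) • (D + D.flip) := by
  have hN : ContDiffAt 𝕜 2 (fun z ↦ c + N z z) 0 := by fun_prop
  have hD : ContDiffAt 𝕜 2 (fun z ↦ 1 + D z z) 0 := by fun_prop
  rw [quadratic_div_sq_eq,
    fderiv_fderiv_div_of_fderiv_eq_zero (q := (fun z ↦ 1 + D z z) * _) hN (hD.mul hD)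
      (fderiv_const_add_bilinear_self_zero c N) (fderiv_one_add_bilinear_self_mul_self_zero D)
      (by simp),
    fderiv_fderiv_mul_of_fderiv_eq_zero hD hD
      (fderiv_const_add_bilinear_self_zero 1 D) (fderiv_const_add_bilinear_self_zero 1 D),
    fderiv_fderiv_const_add_bilinear_self, fderiv_fderiv_const_add_bilinear_self]
  simp only [Pi.mul_apply, add_zero, mul_one, inv_one, one_smul, div_one, map_zero]
  module

end QuadraticDivSq

namespace CoordinateCurvature

section PartialDeriv

variable {E : Type*} [NormedAddCommGroup E] [NormedSpace ℝ E] {ι : Type*}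
  {b : Module.Basis ι ℝ E} {f : E → ℝ} {y : E}

theorem differentiableAt_partialDeriv (hf : ContDiffAt ℝ 2 f y) (α : ι) :
    DifferentiableAt ℝ (partialDeriv b α f) y :=
  ((hf.fderiv_right_succ (n := 1)).differentiableAt one_ne_zero).clm_apply
    (differentiableAt_const (b α))

theorem partialDeriv_partialDeriv (hf : ContDiffAt ℝ 2 f y) (α β : ι) :
    partialDeriv b α (partialDeriv b β f) y = fderiv ℝ (fderiv ℝ f) y (b α) (b β) := by
  have hf' : DifferentiableAt ℝ (fderiv ℝ f) y :=
    (hf.fderiv_right_succ (n := 1)).differentiableAt one_ne_zero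
  exact congr($((hf'.hasFDerivAt.clm_apply (hasFDerivAt_const (b β) y)).fderiv) (b α)).trans
    (by simp)

theorem partialDeriv_comm (hf : ContDiffAt ℝ 2 f y) (α β : ι) :
    partialDeriv b α (partialDeriv b β f) y = partialDeriv b β (partialDeriv b α f) y := by
  rw [partialDeriv_partialDeriv hf, partialDeriv_partialDeriv hf]
  exact hf.isSymmSndFDerivAt (by simp) (b α) (b β)

end PartialDeriv

variable {E : Type*} [NormedAddCommGroup E] [NormedSpace ℝ E] {ι : Type*} [Fintype ι]
  [DecidableEq ι] {b : Module.Basis ι ℝ E} {G : E → E → E → ℝ} {y : E}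

theorem christoffel_eq_zero
    (h_crit : ∀ α β γ, partialDeriv b γ (fun z ↦ gram b G z α β) y = 0) (δ α β : ι) :
    christoffel b G δ α β y = 0 := by
  simp [christoffel, h_crit]

theorem continuousAt_gram_inv (h_cont : ∀ α β, ContinuousAt (fun z ↦ gram b G z α β) y)
    (h_det : IsUnit (gram b G y).det) (α β : ι) :
    ContinuousAt (fun z ↦ (gram b G z)⁻¹ α β) y := by
  have h_gram : ContinuousAt (gram b G) y :=
    continuousAt_pi.2 fun α ↦ continuousAt_pi.2 fun β ↦ h_cont α β
  have h_inv : ContinuousAt (fun z ↦ (gram b G z)⁻¹) y :=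
    (continuousAt_matrix_inv _ (NormedRing.inverse_continuousAt h_det.unit)).comp h_gram
  exact continuousAt_pi.1 (continuousAt_pi.1 h_inv α) β

theorem partialDeriv_christoffel (h_smooth : ∀ α β, ContDiffAt ℝ 2 (fun z ↦ gram b G z α β) y)
    (h_crit : ∀ α β γ, partialDeriv b γ (fun z ↦ gram b G z α β) y = 0)
    (h_det : IsUnit (gram b G y).det) (δ α β γ : ι) :
    partialDeriv b γ (christoffel b G δ α β) y =
      (1 / 2) * ∑ ε, (gram b G y)⁻¹ δ ε *
        (partialDeriv b γ (partialDeriv b α fun z ↦ gram b G z β ε) y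
          + partialDeriv b γ (partialDeriv b β fun z ↦ gram b G z α ε) y
          - partialDeriv b γ (partialDeriv b ε fun z ↦ gram b G z α β) y) := by
  have h_diff (α β γ : ι) :=
    (differentiableAt_partialDeriv (b := b) (h_smooth α β) γ).hasFDerivAt
  have h_summand (ε : ι) := hasFDerivAt_smul_of_continuousAt_of_eq_zero
    (continuousAt_gram_inv (fun α β ↦ (h_smooth α β).continuousAt) h_det δ ε)
    (((h_diff β ε α).add (h_diff α ε β)).sub (h_diff α β ε)) (by simp [h_crit])
  have h_sum := HasFDerivAt.fun_sum fun ε (_ : ε ∈ Finset.univ) ↦ h_summand ε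
  exact congr($((h_sum.const_mul (1 / 2 : ℝ)).fderiv) (b γ)).trans (by simp [partialDeriv])

theorem riemannLow_of_partialDeriv_gram_eq_zero
    (h_smooth : ∀ α β, ContDiffAt ℝ 2 (fun z ↦ gram b G z α β) y)
    (h_crit : ∀ α β γ, partialDeriv b γ (fun z ↦ gram b G z α β) y = 0)
    (h_det : IsUnit (gram b G y).det) (h_symm : (gram b G y).IsSymm) (α β γ δ : ι) :
    riemannLow b G α β γ δ y = (1 / 2) *
      (partialDeriv b β (partialDeriv b γ fun z ↦ gram b G z α δ) y
        + partialDeriv b α (partialDeriv b δ fun z ↦ gram b G z β γ) y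
        - partialDeriv b β (partialDeriv b δ fun z ↦ gram b G z α γ) y
        - partialDeriv b α (partialDeriv b γ fun z ↦ gram b G z β δ) y) := by
  have h_lower (T : ι → ℝ) : ∑ ε, (∑ η, (gram b G y)⁻¹ ε η * T η) * gram b G y ε δ = T δ := by
    have := congrFun (Matrix.mulVec_mulVec T (gram b G y) (gram b G y)⁻¹) δ
    rw [Matrix.mul_nonsing_inv _ h_det, Matrix.one_mulVec] at this
    rw [← this]
    exact Finset.sum_congr rfl fun ε _ ↦ by rw [mul_comm, h_symm.apply]; rfl
  simp only [riemannLow, riemannUp, christoffel_eq_zero h_crit,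
    partialDeriv_christoffel h_smooth h_crit h_det, mul_zero, sub_zero, Finset.sum_const_zero,
    add_zero, ← mul_sub, ← Finset.sum_sub_distrib, mul_assoc, ← Finset.mul_sum, h_lower]
  rw [partialDeriv_comm (h_smooth γ δ) β α, partialDeriv_comm (h_smooth β γ) α δ]
  ring

end CoordinateCurvature

section OrthogonalMultiplication

open scoped RealInnerProductSpace

variable {E F G : Type*} [NormedAddCommGroup E] [InnerProductSpace ℝ E] [NormedAddCommGroup F]
  [InnerProductSpace ℝ F] [NormedAddCommGroup G] [InnerProductSpace ℝ G]

/-- An orthogonal multiplication (or composition of quadratic forms): a bilinear map between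
Euclidean spaces that multiplies norms. -/
def IsOrthogonalMultiplication (B : E →L[ℝ] F →L[ℝ] G) : Prop :=
  ∀ a b, ‖B a b‖ = ‖a‖ * ‖b‖

namespace IsOrthogonalMultiplication

variable {B : E →L[ℝ] F →L[ℝ] G}

theorem inner_right (hB : IsOrthogonalMultiplication B) (a : E) (b d : F) :
    ⟪B a b, B a d⟫ = ‖a‖ ^ 2 * ⟪b, d⟫ := by
  have h := hB a (b + d)
  rw [← sq_eq_sq₀ (norm_nonneg _) (by positivity), mul_pow, map_add, norm_add_sq_real,
    norm_add_sq_real, hB a b, hB a d] at h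
  linear_combination h / 2

theorem inner_add_inner (hB : IsOrthogonalMultiplication B) (a c : E) (b d : F) :
    ⟪B a b, B c d⟫ + ⟪B a d, B c b⟫ = 2 * ⟪a, c⟫ * ⟪b, d⟫ := by
  have h := hB.inner_right (a + c) b d
  simp only [map_add, add_apply, inner_add_left, inner_add_right, hB.inner_right,
    norm_add_sq_real] at h
  rw [real_inner_comm (B c b)]
  linear_combination h

end IsOrthogonalMultiplication

/-- The pullback of the inner product of `E` along a continuous linear map, as a bilinear form. -/
noncomputable def innerPullback {H : Type*} [NormedAddCommGroup H] [NormedSpace ℝ H]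
    (L : H →L[ℝ] E) : H →L[ℝ] H →L[ℝ] ℝ :=
  (innerSL ℝ).bilinearComp L L

section PlaneMetric

variable (B : E →L[ℝ] F →L[ℝ] G)

/-- The Fubini–Study type metric on `E × F`, at the point `w` and on the tangent vectors `s` and
`t`, that is defined by a multiplication `B : E × F → G`. For `B u v = u v̄` on a normed division
algebra it is the metric of the projective plane in an affine chart. -/
noncomputable def planeMetric (w s t : E × F) : ℝ :=
  (⟪s.1, t.1⟫ * (1 + ‖w.2‖ ^ 2) + ⟪s.2, t.2⟫ * (1 + ‖w.1‖ ^ 2)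
    - ⟪B w.1 w.2, B t.1 s.2 + B s.1 t.2⟫) / (1 + ‖w.1‖ ^ 2 + ‖w.2‖ ^ 2) ^ 2

/-- The curvature tensor of `planeMetric B` at the origin, for an orthogonal multiplication `B`. -/
noncomputable def planeCurvature (X Y Z W : E × F) : ℝ :=
  4 * ⟪X.1, Z.1⟫ * ⟪Y.1, W.1⟫ - 4 * ⟪Y.1, Z.1⟫ * ⟪X.1, W.1⟫
  + 4 * ⟪X.2, Z.2⟫ * ⟪Y.2, W.2⟫ - 4 * ⟪Y.2, Z.2⟫ * ⟪X.2, W.2⟫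
  - ⟪B Z.1 Y.2, B W.1 X.2⟫ + ⟪B Z.1 X.2, B W.1 Y.2⟫
  - ⟪B Y.1 Z.2, B X.1 W.2⟫ + ⟪B X.1 Z.2, B Y.1 W.2⟫
  - ⟪B X.1 Y.2 - B Y.1 X.2, B W.1 Z.2 - B Z.1 W.2⟫

variable (E F) in
/-- The Euclidean inner product of `E × F`, whose norm in Mathlib is the supremum norm. -/
noncomputable def prodInner : E × F →L[ℝ] E × F →L[ℝ] ℝ :=
  innerPullback (.fst ℝ E F) + innerPullback (.snd ℝ E F)

theorem prodInner_apply (s t : E × F) : prodInner E F s t = ⟪s.1, t.1⟫ + ⟪s.2, t.2⟫ := rfl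

/-- The part of the numerator of `planeMetric B w s t` that is quadratic in `w`, as a bilinear
form. -/
noncomputable def planeMetricNumerator (s t : E × F) : E × F →L[ℝ] E × F →L[ℝ] ℝ :=
  ⟪s.1, t.1⟫ • innerPullback (.snd ℝ E F) + ⟪s.2, t.2⟫ • innerPullback (.fst ℝ E F)
    - (ContinuousLinearMap.compL ℝ F G ℝ (innerSL ℝ (B t.1 s.2 + B s.1 t.2)) ∘L B).bilinearComp
        (.fst ℝ E F) (.snd ℝ E F)

theorem planeMetricNumerator_apply (s t w z : E × F) :
    planeMetricNumerator B s t w z = ⟪s.1, t.1⟫ * ⟪w.2, z.2⟫ + ⟪s.2, t.2⟫ * ⟪w.1, z.1⟫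
      - ⟪B t.1 s.2 + B s.1 t.2, B w.1 z.2⟫ :=
  rfl

theorem planeMetric_eq_quadratic_div_sq (s t : E × F) :
    (fun w ↦ planeMetric B w s t) = fun w ↦
      (prodInner E F s t + planeMetricNumerator B s t w w) / (1 + prodInner E F w w) ^ 2 := by
  funext w
  simp only [planeMetric, prodInner_apply, planeMetricNumerator_apply, real_inner_self_eq_norm_sq,
    real_inner_comm (B w.1 w.2)]
  ring

theorem planeMetric_zero (s t : E × F) : planeMetric B 0 s t = prodInner E F s t := by
  simp [planeMetric, prodInner_apply]

theorem det_prodInner_ne_zero {ι : Type*} [Fintype ι] [DecidableEq ι]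
    (b : Module.Basis ι ℝ (E × F)) :
    (Matrix.of fun α β ↦ prodInner E F (b α) (b β)).det ≠ 0 :=
  Matrix.det_gram_ne_zero_iff_linearIndependent.2
    (b.map (WithLp.linearEquiv 2 ℝ (E × F)).symm).linearIndependent

variable {B}

theorem fderiv_fderiv_planeMetric_zero (s t X Y : E × F) :
    fderiv ℝ (fderiv ℝ fun w ↦ planeMetric B w s t) 0 X Y =
      2 * (⟪s.1, t.1⟫ * ⟪X.2, Y.2⟫ + ⟪s.2, t.2⟫ * ⟪X.1, Y.1⟫)
        - ⟪B t.1 s.2 + B s.1 t.2, B X.1 Y.2 + B Y.1 X.2⟫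
        - 4 * (⟪s.1, t.1⟫ + ⟪s.2, t.2⟫) * (⟪X.1, Y.1⟫ + ⟪X.2, Y.2⟫) := by
  rw [planeMetric_eq_quadratic_div_sq, fderiv_fderiv_quadratic_div_sq_zero]
  simp only [sub_apply, add_apply, smul_apply, smul_eq_mul, ContinuousLinearMap.flip_apply,
    planeMetricNumerator_apply, prodInner_apply, inner_add_right, real_inner_comm X.1,
    real_inner_comm X.2]
  ring

theorem IsOrthogonalMultiplication.fderiv_fderiv_planeMetric (hB : IsOrthogonalMultiplication B)
    (X Y Z W : E × F) :
    (1 / 2) * (fderiv ℝ (fderiv ℝ fun w ↦ planeMetric B w X W) 0 Y Z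
        + fderiv ℝ (fderiv ℝ fun w ↦ planeMetric B w Y Z) 0 X W
        - fderiv ℝ (fderiv ℝ fun w ↦ planeMetric B w X Z) 0 Y W
        - fderiv ℝ (fderiv ℝ fun w ↦ planeMetric B w Y W) 0 X Z) =
      planeCurvature B X Y Z W := by
  obtain ⟨a, b⟩ := X
  obtain ⟨c, d⟩ := Y
  obtain ⟨e, f⟩ := Z
  obtain ⟨g, h⟩ := W
  simp only [fderiv_fderiv_planeMetric_zero, planeCurvature, inner_sub_left, inner_sub_right,
    inner_add_left, inner_add_right]
  linear_combination (norm := (simp only [real_inner_comm]; ring))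
    hB.inner_add_inner a g d f + hB.inner_add_inner c e b h - hB.inner_add_inner a e d h
      - hB.inner_add_inner c g b f

open CoordinateCurvature in
theorem IsOrthogonalMultiplication.riemannLow_planeMetric (hB : IsOrthogonalMultiplication B)
    {ι : Type*} [Fintype ι] [DecidableEq ι] (b : Module.Basis ι ℝ (E × F)) (α β γ δ : ι) :
    riemannLow b (planeMetric B) α β γ δ 0 = planeCurvature B (b α) (b β) (b γ) (b δ) := by
  have h_gram_zero : gram b (planeMetric B) 0 = Matrix.of fun α β ↦ prodInner E F (b α) (b β) := by
    ext; simp [gram, planeMetric_zero]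
  have h_gram (α β : ι) : (fun z ↦ gram b (planeMetric B) z α β) =
      fun z ↦ planeMetric B z (b α) (b β) := rfl
  have h_smooth (α β : ι) : ContDiffAt ℝ 2 (fun z ↦ planeMetric B z (b α) (b β)) 0 := by
    rw [planeMetric_eq_quadratic_div_sq]
    exact contDiffAt_quadratic_div_sq_zero _ _ _
  rw [riemannLow_of_partialDeriv_gram_eq_zero]
  · simp only [h_gram, partialDeriv_partialDeriv (h_smooth _ _), hB.fderiv_fderiv_planeMetric]
  · exact h_smooth
  · intro α β γ
    rw [h_gram, partialDeriv, planeMetric_eq_quadratic_div_sq, fderiv_quadratic_div_sq_zero,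
      zero_apply]
  · rw [h_gram_zero]
    exact (det_prodInner_ne_zero b).isUnit
  · rw [h_gram_zero]
    ext
    simp [prodInner_apply, real_inner_comm]

end PlaneMetric

section PlaneCurvature

variable (B : E →L[ℝ] F →L[ℝ] G)

theorem planeCurvature_swap_left (X Y Z W : E × F) :
    planeCurvature B Y X Z W = -planeCurvature B X Y Z W := by
  simp only [planeCurvature, inner_sub_left, inner_sub_right]
  ring

theorem planeCurvature_pair_symm (X Y Z W : E × F) :
    planeCurvature B Z W X Y = planeCurvature B X Y Z W := by
  simp only [planeCurvature, inner_sub_left, inner_sub_right, real_inner_comm]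
  ring

theorem isLinearMap_planeCurvature (Y Z W : E × F) :
    IsLinearMap ℝ fun X ↦ planeCurvature B X Y Z W where
  map_add X X' := by
    simp only [planeCurvature, Prod.fst_add, Prod.snd_add, map_add, add_apply, inner_add_left,
      inner_add_right, inner_sub_left]
    ring
  map_smul r X := by
    simp only [planeCurvature, Prod.smul_fst, Prod.smul_snd, map_smul, smul_apply,
      real_inner_smul_left, real_inner_smul_right, inner_sub_left, smul_eq_mul]
    ring

theorem planeCurvature_fst_fst_fst_fst (a c e g : E) :
    planeCurvature B (a, 0) (c, 0) (e, 0) (g, 0) = 4 * (⟪a, e⟫ * ⟪c, g⟫ - ⟪c, e⟫ * ⟪a, g⟫) := by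
  simp [planeCurvature, mul_sub, mul_assoc]

theorem planeCurvature_snd_snd_snd_snd (b d f h : F) :
    planeCurvature B (0, b) (0, d) (0, f) (0, h) = 4 * (⟪b, f⟫ * ⟪d, h⟫ - ⟪d, f⟫ * ⟪b, h⟫) := by
  simp [planeCurvature, mul_sub, mul_assoc]

theorem planeCurvature_fst_fst_snd_snd (a c : E) (f h : F) :
    planeCurvature B (a, 0) (c, 0) (0, f) (0, h) =
      -⟪B a h, B c f⟫ + ⟪B c h, B a f⟫ := by
  simp [planeCurvature, real_inner_comm]

theorem planeCurvature_fst_snd_fst_snd (a e : E) (d h : F) :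
    planeCurvature B (a, 0) (0, d) (e, 0) (0, h) = ⟪B a d, B e h⟫ := by
  simp [planeCurvature]

theorem planeCurvature_fst_fst_fst_snd (a c e : E) (h : F) :
    planeCurvature B (a, 0) (c, 0) (e, 0) (0, h) = 0 := by
  simp [planeCurvature]

theorem planeCurvature_snd_snd_snd_fst (b d f : F) (g : E) :
    planeCurvature B (0, b) (0, d) (0, f) (g, 0) = 0 := by
  simp [planeCurvature]

end PlaneCurvature

end OrthogonalMultiplication

section BasisExpansion

variable {V ι : Type*} [AddCommGroup V] [Module ℝ V] [Fintype ι] (b : Module.Basis ι ℝ V)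

theorem sum_repr_mul_of_isLinearMap {φ : V → ℝ} (hφ : IsLinearMap ℝ φ) (X : V) :
    ∑ α, b.repr X α * φ (b α) = φ X := by
  conv_rhs => rw [← b.sum_repr X]
  exact ((map_sum (hφ.mk' φ) _ _).trans (by simp)).symm

theorem sum_repr_mul_of_curvature_symmetries {T : V → V → V → V → ℝ}
    (h_linear : ∀ Y Z W, IsLinearMap ℝ fun X ↦ T X Y Z W)
    (h_swap : ∀ X Y Z W, T Y X Z W = -T X Y Z W) (h_pair : ∀ X Y Z W, T Z W X Y = T X Y Z W)
    (X Y Z W : V) :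
    ∑ α, ∑ β, ∑ γ, ∑ δ, b.repr X α * b.repr Y β * b.repr Z γ * b.repr W δ *
      T (b α) (b β) (b γ) (b δ) = T X Y Z W := by
  have h_first (X Y Z W) : ∑ α, b.repr X α * T (b α) Y Z W = T X Y Z W :=
    sum_repr_mul_of_isLinearMap b (h_linear Y Z W) X
  have h_second (X Y Z W) : ∑ β, b.repr Y β * T X (b β) Z W = T X Y Z W := by
    simp only [h_swap _ X, mul_neg, Finset.sum_neg_distrib, h_first]
  have h_third (X Y Z W) : ∑ γ, b.repr Z γ * T X Y (b γ) W = T X Y Z W := by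
    simp only [h_pair _ W, h_first]
  have h_fourth (X Y Z W) : ∑ δ, b.repr W δ * T X Y Z (b δ) = T X Y Z W := by
    simp only [h_pair Z, h_second]
  simp only [mul_assoc, ← Finset.mul_sum, h_first, h_second, h_third, h_fourth]

end BasisExpansion

namespace Octonion

open scoped RealInnerProductSpace

/-- The multiplication `(a, b) ↦ a b̄` as a continuous bilinear map. -/
noncomputable def mulStar : Octonion →L[ℝ] Octonion →L[ℝ] Octonion :=
  ((LinearMap.mul ℝ Octonion).compl₂ starL).toContinuousBilinearMap

theorem mulStar_apply (a b : Octonion) : mulStar a b = a * star b := rfl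

theorem isOrthogonalMultiplication_mulStar : IsOrthogonalMultiplication mulStar := fun a b ↦ by
  rw [mulStar_apply, norm_mul', norm_star']

theorem re_mul_mul_star (a b c : Octonion) : re (a * (b * star c)) = ip a (c * star b) := by
  rw [ip, star_mul', star_star']

theorem ip_star_star (a b : Octonion) : ip (star a) (star b) = ip a b := by
  simp [ip_eq]

theorem ip_mul_star_swap (a b c d : Octonion) :
    ip (b * star a) (d * star c) = ip (a * star b) (c * star d) := by
  rw [← ip_star_star (a * star b), star_mul', star_mul', star_star', star_star']

theorem ip_x (i j : Fin 8) : ip (x i) (x j) = if i = j then 1 else 0 := by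
  have ip_eq_sum_repr (a b : Octonion) : ip a b = ∑ k, x.repr a k * x.repr b k := by
    rw [ip_eq, Fin.sum_univ_eight]
    rfl
  simp [ip_eq_sum_repr, Finsupp.single_apply]

end Octonion

namespace OP2

open Octonion CoordinateCurvature
open scoped Manifold

theorem metricForm_eq_planeMetric : metricForm = planeMetric mulStar := by
  funext w s t
  simp only [metricForm, planeMetric, mulStar_apply, re_mul_mul_star, normSq_eq, ip_eq_inner,
    inner_add_right]

theorem chartAt_eq_of_mem {P : OP2} (hP : P ∈ U 0) :
    chartAt (Octonion × Octonion) P = chart 0 := by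
  change chart (chartIndex P) = chart 0
  rw [chartIndex, if_pos hP]

theorem chartAt_point (y : Octonion × Octonion) :
    chartAt (Octonion × Octonion) (point 0 y) (point 0 y) = y := by
  rw [chartAt_eq_of_mem (point_mem 0 y)]
  exact coord_point 0 y

theorem mfderiv_point_zero (y : Octonion × Octonion) :
    mfderiv 𝓘(ℝ, Octonion × Octonion) 𝓘(ℝ, Octonion × Octonion) (point 0) y =
      ContinuousLinearMap.id ℝ (Octonion × Octonion) := by
  have writtenInExtChartAt_point :
      writtenInExtChartAt 𝓘(ℝ, Octonion × Octonion) 𝓘(ℝ, Octonion × Octonion) y (point 0) = id := by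
    funext z
    simp only [writtenInExtChartAt, extChartAt, chartAt_eq_of_mem (point_mem 0 y)]
    exact coord_point 0 z
  refine HasMFDerivAt.mfderiv ⟨(continuous_point 0).continuousAt, ?_⟩
  rw [writtenInExtChartAt_point]
  exact hasFDerivWithinAt_id _ _

theorem metricInChart_P₀ : metricInChart metric P₀ = metricForm := by
  funext y v w
  have mfderiv_apply (s : Octonion × Octonion) :
      mfderiv 𝓘(ℝ, Octonion × Octonion) 𝓘(ℝ, Octonion × Octonion) (point 0) y s = s := by
    rw [mfderiv_point_zero]
    rfl
  rw [metricInChart, chartAt_P₀]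
  exact congr (congr (congrArg metricForm (chartAt_point y)) (mfderiv_apply v)) (mfderiv_apply w)

theorem R_eq_planeCurvature (X Y Z W : Octonion × Octonion) :
    R X Y Z W = planeCurvature mulStar X Y Z W := by
  change ∑ α, ∑ β, ∑ γ, ∑ δ,
    frame.repr X α * frame.repr Y β * frame.repr Z γ * frame.repr W δ *
      riemannLow frame (metricInChart metric P₀) α β γ δ (chartAt (Octonion × Octonion) P₀ P₀) = _
  rw [metricInChart_P₀, P₀, chartAt_point, metricForm_eq_planeMetric, Prod.mk_zero_zero]
  simp only [isOrthogonalMultiplication_mulStar.riemannLow_planeMetric]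
  exact sum_repr_mul_of_curvature_symmetries frame (isLinearMap_planeCurvature mulStar)
    (planeCurvature_swap_left mulStar) (planeCurvature_pair_symm mulStar) X Y Z W

theorem R_tangent (a b c d e f g h : Octonion) :
    R (tangent a b) (tangent c d) (tangent e f) (tangent g h) =
      4 * ip a e * ip c g - 4 * ip c e * ip a g + 4 * ip b f * ip d h - 4 * ip d f * ip b h
      - ip (e * star d) (g * star b) + ip (e * star b) (g * star d)
      - ip (c * star f) (a * star h) + ip (a * star f) (c * star h)
      - ip (a * star d - c * star b) (g * star f - e * star h) := by
  simp only [ip_eq_inner]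
  exact R_eq_planeCurvature (a, b) (c, d) (e, f) (g, h)

section Symmetries

variable (X Y Z W : TangentSpace 𝓘(ℝ, Octonion × Octonion) P₀)

theorem R_swap_left : R Y X Z W = -R X Y Z W :=
  (R_eq_planeCurvature Y X Z W).trans <| (planeCurvature_swap_left mulStar X Y Z W).trans <|
    congrArg Neg.neg (R_eq_planeCurvature X Y Z W).symm

theorem R_pair_symm : R Z W X Y = R X Y Z W :=
  (R_eq_planeCurvature Z W X Y).trans <| (planeCurvature_pair_symm mulStar X Y Z W).trans
    (R_eq_planeCurvature X Y Z W).symm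

theorem R_swap_right : R X Y W Z = -R X Y Z W := by
  rw [R_pair_symm, R_swap_left, R_pair_symm]

end Symmetries

theorem e_eq (i : Fin 8) : e i = ((x i, 0) : Octonion × Octonion) :=
  Prod.ext (x.prod_apply_inl_fst x i) (x.prod_apply_inl_snd x i)

theorem f_eq (i : Fin 8) : f i = ((0, x i) : Octonion × Octonion) :=
  Prod.ext (x.prod_apply_inr_fst x i) (x.prod_apply_inr_snd x i)

section Components

variable (i j k l : Fin 8)

theorem R_e_e_e_e : R (e i) (e j) (e k) (e l) =
    4 * (ip (x i) (x k) * ip (x j) (x l) - ip (x j) (x k) * ip (x i) (x l)) := by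
  simp only [e_eq, R_eq_planeCurvature, planeCurvature_fst_fst_fst_fst, ip_eq_inner]

theorem R_f_f_f_f : R (f i) (f j) (f k) (f l) =
    4 * (ip (x i) (x k) * ip (x j) (x l) - ip (x j) (x k) * ip (x i) (x l)) := by
  simp only [f_eq, R_eq_planeCurvature, planeCurvature_snd_snd_snd_snd, ip_eq_inner]

theorem R_e_e_f_f : R (e i) (e j) (f k) (f l) =
    -ip (x i * star (x l)) (x j * star (x k)) + ip (x j * star (x l)) (x i * star (x k)) := by
  simp only [e_eq, f_eq, R_eq_planeCurvature, planeCurvature_fst_fst_snd_snd, mulStar_apply,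
    ip_eq_inner]

theorem R_e_f_e_f :
    R (e i) (f j) (e k) (f l) = ip (x i * star (x j)) (x k * star (x l)) := by
  simp only [e_eq, f_eq, R_eq_planeCurvature, planeCurvature_fst_snd_fst_snd, mulStar_apply,
    ip_eq_inner]

theorem R_f_e_f_e :
    R (f i) (e j) (f k) (e l) = ip (x i * star (x j)) (x k * star (x l)) := by
  rw [R_swap_left, R_swap_right, neg_neg, R_e_f_e_f, ip_mul_star_swap]

theorem R_e_e_e_f : R (e i) (e j) (e k) (f l) = 0 := by
  simp only [e_eq, f_eq, R_eq_planeCurvature, planeCurvature_fst_fst_fst_snd]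

theorem R_f_f_f_e : R (f i) (f j) (f k) (e l) = 0 := by
  simp only [e_eq, f_eq, R_eq_planeCurvature, planeCurvature_snd_snd_snd_fst]

theorem R_e_e_f_e : R (e i) (e j) (f k) (e l) = 0 := by
  rw [R_swap_right, R_e_e_e_f, neg_zero]

theorem R_f_f_e_f : R (f i) (f j) (e k) (f l) = 0 := by
  rw [R_swap_right, R_f_f_f_e, neg_zero]

end Components

end OP2

theorem mainTheorem2 :
    -- (1) and (2): components of types `eeee` and `ffff`
    (∀ i j : Fin 8, i ≠ j →
      OP2.R (OP2.e i) (OP2.e j) (OP2.e i) (OP2.e j) = 4 ∧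
      -OP2.R (OP2.e i) (OP2.e j) (OP2.e j) (OP2.e i) = 4 ∧
      OP2.R (OP2.f i) (OP2.f j) (OP2.f i) (OP2.f j) = 4 ∧
      -OP2.R (OP2.f i) (OP2.f j) (OP2.f j) (OP2.f i) = 4) ∧
    -- the other components of these two types vanish
    (∀ i j k l : Fin 8, ¬(i ≠ j ∧ (k = i ∧ l = j ∨ k = j ∧ l = i)) →
      OP2.R (OP2.e i) (OP2.e j) (OP2.e k) (OP2.e l) = 0 ∧
      OP2.R (OP2.f i) (OP2.f j) (OP2.f k) (OP2.f l) = 0) ∧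
    -- (3)
    (∀ i j k l : Fin 8,
      OP2.R (OP2.e i) (OP2.e j) (OP2.f k) (OP2.f l) =
        -Octonion.ip (Octonion.x i * star (Octonion.x l)) (Octonion.x j * star (Octonion.x k))
          + Octonion.ip (Octonion.x j * star (Octonion.x l)) (Octonion.x i * star (Octonion.x k)) ∧
      OP2.R (OP2.f k) (OP2.f l) (OP2.e i) (OP2.e j) =
        -Octonion.ip (Octonion.x i * star (Octonion.x l)) (Octonion.x j * star (Octonion.x k))
          + Octonion.ip (Octonion.x j * star (Octonion.x l))
              (Octonion.x i * star (Octonion.x k))) ∧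
    -- (4)
    (∀ i j k l : Fin 8,
      OP2.R (OP2.e i) (OP2.f j) (OP2.e k) (OP2.f l) =
        Octonion.ip (Octonion.x i * star (Octonion.x j)) (Octonion.x k * star (Octonion.x l)) ∧
      OP2.R (OP2.f i) (OP2.e j) (OP2.f k) (OP2.e l) =
        Octonion.ip (Octonion.x i * star (Octonion.x j)) (Octonion.x k * star (Octonion.x l)) ∧
      OP2.R (OP2.e i) (OP2.f j) (OP2.f l) (OP2.e k) =
        -Octonion.ip (Octonion.x i * star (Octonion.x j)) (Octonion.x k * star (Octonion.x l)) ∧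
      OP2.R (OP2.f i) (OP2.e j) (OP2.e l) (OP2.f k) =
        -Octonion.ip (Octonion.x i * star (Octonion.x j)) (Octonion.x k * star (Octonion.x l))) ∧
    -- components with an odd number of `e`s vanish
    (∀ i j k l : Fin 8,
      OP2.R (OP2.e i) (OP2.e j) (OP2.e k) (OP2.f l) = 0 ∧
      OP2.R (OP2.e i) (OP2.e j) (OP2.f k) (OP2.e l) = 0 ∧
      OP2.R (OP2.e i) (OP2.f j) (OP2.e k) (OP2.e l) = 0 ∧
      OP2.R (OP2.f i) (OP2.e j) (OP2.e k) (OP2.e l) = 0 ∧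
      OP2.R (OP2.f i) (OP2.f j) (OP2.f k) (OP2.e l) = 0 ∧
      OP2.R (OP2.f i) (OP2.f j) (OP2.e k) (OP2.f l) = 0 ∧
      OP2.R (OP2.f i) (OP2.e j) (OP2.f k) (OP2.f l) = 0 ∧
      OP2.R (OP2.e i) (OP2.f j) (OP2.f k) (OP2.f l) = 0) ∧
    -- the component-free formula
    (∀ a b c d e f g h : Octonion,
      OP2.R (OP2.tangent a b) (OP2.tangent c d) (OP2.tangent e f) (OP2.tangent g h) =
        4 * Octonion.ip a e * Octonion.ip c g - 4 * Octonion.ip c e * Octonion.ip a g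
        + 4 * Octonion.ip b f * Octonion.ip d h - 4 * Octonion.ip d f * Octonion.ip b h
        - Octonion.ip (e * star d) (g * star b) + Octonion.ip (e * star b) (g * star d)
        - Octonion.ip (c * star f) (a * star h) + Octonion.ip (a * star f) (c * star h)
        - Octonion.ip (a * star d - c * star b) (g * star f - e * star h)) := by
  open OP2 Octonion in
  refine ⟨fun i j hij ↦ ?_, fun i j k l hijkl ↦ ?_, fun i j k l ↦ ?_, fun i j k l ↦ ?_,
    fun i j k l ↦ ?_, R_tangent⟩
  · simp [R_e_e_e_e, R_f_f_f_f, ip_x, hij, hij.symm]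
  · simp only [R_e_e_e_e, R_f_f_f_f, ip_x]
    grind
  · exact ⟨R_e_e_f_f i j k l, (R_pair_symm _ _ _ _).trans (R_e_e_f_f i j k l)⟩
  · rw [R_swap_right (e i) (f j) (e k), R_swap_right (f i) (e j) (f k), R_e_f_e_f, R_f_e_f_e]
    exact ⟨rfl, rfl, rfl, rfl⟩
  · refine ⟨R_e_e_e_f i j k l, R_e_e_f_e i j k l, ?_, ?_, R_f_f_f_e i j k l, R_f_f_e_f i j k l,
      ?_, ?_⟩ <;> rw [R_pair_symm]
    exacts [R_e_e_e_f .., R_e_e_f_e .., R_f_f_f_e .., R_f_f_e_f ..]
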